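/- **Lemma 2.16.** Let $\Phi$ be a finite reduced root system (not necessarily crystallographic) spanning a real vector space $V$ of dimension $n$, with simple roots $\Delta=\{\alpha_s : s\in S\}$, where $S$ is the set of simple reflections and $(W,S)$ is the associated finite Coxeter system. Let $w_\circ$ be the longest element of $W$, and let $\mathrm{c}=(c_1,\dots,c_n)$ be a reduced expression of a Coxeter element $c$ of $W$ (a product of all simple reflections, each taken once, in some order). Let $\mathrm{w}_\circ(\mathrm{c})$ be the $\mathrm{c}$-sorting word of $w_\circ$, i.e. the lexicographically first subword (as a sequence of positions) of the infinite word $\mathrm{c}^\infty=\mathrm{c}\,\mathrm{c}\,\mathrm{c}\cdots$ that is a reduced expression of $w_\circ$. Let $\mathrm{Q}_{\mathrm{c}}=\mathrm{c}\,\mathrm{w}_\circ(\mathrm{c})=(q_1,\dots,q_m)$ be their concatenation. A subset $I\subseteq[m]$ is a *$\mathrm{c}$-cluster* if the subword of $\mathrm{Q}_{\mathrm{c}}$ at the positions of $[m]\setminus I$ is a reduced expression of $w_\circ$. For a $\mathrm{c}$-cluster $I$ and $j\in[m]$ put $$r(I,j):=\Big(\prod_{x\in[j-1]\setminus I} q_x\Big)(\alpha_{q_j}),$$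 the product being taken in increasing order of the positions $x$. Then, for every $\mathrm{c}$-cluster $I$, the family $R(I)=(r(I,i))_{i\in I}$ is a basis of $V$. For a $\mathrm{c}$-cluster $I$ and $j\in[m]$, write $r(I,j)=\sum_{i\in I}\rho_i(j)\,r(I,i)$, and for $i\in I$ set $$\{i\parallel_{\mathrm{c}}j\}:=\begin{cases}\rho_i(j)&\text{if } j>i,\\-\rho_i(j)&\text{if } j\le i.\end{cases}$$ Then, for all positions $i,j\in[m]$, the coefficient $\{i\parallel_{\mathrm{c}}j\}$ is independent of the choice of the $\mathrm{c}$-cluster $I$ containing $i$: any two $\mathrm{c}$-clusters containing $i$ give the same value. -/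

import Mathlib

/-- A simple system `Δ = {α_1, …, α_n}` of a root system `P` in a real vector space: `n` roots,
indexed by `Fin n`, that are linearly independent and such that each root is a linear combination
of them with coefficients all of the same sign (nonnegative or nonpositive). -/
structure RootPairing.SimpleSystem {ι V N : Type*} [AddCommGroup V] [Module ℝ V]
    [AddCommGroup N] [Module ℝ N] (P : RootPairing ι ℝ V N) (n : ℕ) where
  /-- The index of the `s`-th simple root. -/
  idx : Fin n → ι
  linearIndependent : LinearIndependent ℝ fun s => P.root (idx s)
  nonneg_or_nonpos : ∀ k : ι, ∃ a : Fin n → ℝ,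
    P.root k = ∑ s, a s • P.root (idx s) ∧ ((∀ s, 0 ≤ a s) ∨ (∀ s, a s ≤ 0))

namespace RootPairing.SimpleSystem

variable {ι V N : Type*} [AddCommGroup V] [Module ℝ V] [AddCommGroup N] [Module ℝ N]
  {P : RootPairing ι ℝ V N} {n : ℕ} (Δ : P.SimpleSystem n)

/-- The simple root `α_s`. -/
def simpleRoot (s : Fin n) : V := P.root (Δ.idx s)

/-- The simple reflection through `α_s`, as a linear automorphism of `V`. -/
def simpleReflection (s : Fin n) : V ≃ₗ[ℝ] V := P.reflection (Δ.idx s)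

/-- The reflection group `W` generated by the set `S` of simple reflections. -/
def coxeterGroup : Subgroup (V ≃ₗ[ℝ] V) := Subgroup.closure (Set.range Δ.simpleReflection)

/-- The element of `W` spelled by a word in the simple reflections. The product is composition of
maps, so the last letter acts first. -/
def wordProd (ω : List (Fin n)) : V ≃ₗ[ℝ] V := (ω.map Δ.simpleReflection).prod

/-- The Coxeter length of an element of `W`: the least number of letters of a word spelling it. -/
noncomputable def length (w : V ≃ₗ[ℝ] V) : ℕ :=
  sInf {k | ∃ ω : List (Fin n), ω.length = k ∧ Δ.wordProd ω = w}

/-- The word `ω` is a reduced expression of `w`. -/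
def IsReducedExpr (ω : List (Fin n)) (w : V ≃ₗ[ℝ] V) : Prop :=
  Δ.wordProd ω = w ∧ ω.length = Δ.length w

/-- `w` is the longest element `w_∘` of `W`. -/
def IsLongest (w : V ≃ₗ[ℝ] V) : Prop :=
  w ∈ Δ.coxeterGroup ∧ ∀ v ∈ Δ.coxeterGroup, Δ.length v ≤ Δ.length w

/-- `w` is a Coxeter element: a product of all simple reflections, each taken once, in some
order. -/
def IsCoxeterElement (w : V ≃ₗ[ℝ] V) : Prop :=
  ∃ l : List (Fin n), l.Nodup ∧ (∀ s, s ∈ l) ∧ Δ.wordProd l = w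

/-- `w` is the subword of the infinite word `c^∞ = c c c ⋯` at the positions listed in `p`.
Positions are counted from `0`, and the letter of `c^∞` at position `k` is the letter of `c` at
position `k` modulo the length of `c`. -/
def IsSubwordAt (c : List (Fin n)) (p : List ℕ) (w : List (Fin n)) : Prop :=
  p.Pairwise (· < ·) ∧ p.map (fun k => getElem? c (k % c.length)) = w.map some

/-- `w` is the `c`-sorting word of `x`: the subword of `c^∞` whose list of positions is
lexicographically first among those at which a reduced expression of `x` can be read. -/
def IsSortingWord (c : List (Fin n)) (x : V ≃ₗ[ℝ] V) (w : List (Fin n)) : Prop :=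
  ∃ p : List ℕ, IsSubwordAt c p w ∧ Δ.IsReducedExpr w x ∧
    ∀ (p' : List ℕ) (w' : List (Fin n)),
      IsSubwordAt c p' w' → Δ.IsReducedExpr w' x → p ≤ p'

/-- The subword of `Q` formed by the positions in `X`. -/
def subword (Q : List (Fin n)) (X : Finset (Fin Q.length)) : List (Fin n) :=
  ((List.finRange Q.length).filter (· ∈ X)).map Q.get

/-- A set `I` of positions in `Q` is a cluster if the subword of `Q` formed by the complement of
`I` is a reduced expression of `w₀`. For `w₀ = w_∘` and `Q = c w_∘(c)` these are the
`c`-clusters. -/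
def IsCluster (w₀ : V ≃ₗ[ℝ] V) (Q : List (Fin n)) (I : Finset (Fin Q.length)) : Prop :=
  Δ.IsReducedExpr (subword Q Iᶜ) w₀

/-- The root function `r(I, j)`: the image of the simple root of the `j`-th letter of `Q` under
the product, in order, of the letters of `Q` at the positions before `j` that are not in `I`. -/
def rootFunction (Q : List (Fin n)) (I : Finset (Fin Q.length)) (j : Fin Q.length) : V :=
  Δ.wordProd (subword Q (Finset.Iio j \ I)) (Δ.simpleRoot (Q.get j))

/-- The root configuration `R(I)`, as a family indexed by `I`. -/
def rootConfiguration (Q : List (Fin n)) (I : Finset (Fin Q.length)) : I → V :=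
  fun i => Δ.rootFunction Q I i

/-- The family `R(I)` is a basis of `V`. -/
def RootConfigurationIsBasis (Q : List (Fin n)) (I : Finset (Fin Q.length)) : Prop :=
  LinearIndependent ℝ (Δ.rootConfiguration Q I) ∧
    ⊤ ≤ Submodule.span ℝ (Set.range (Δ.rootConfiguration Q I))

open Classical in
/-- The coefficient `ρ_i(j)` of `r(I, i)` in the decomposition of `r(I, j)` on the basis `R(I)`
(the value is `0` by convention if `R(I)` is not a basis). -/
noncomputable def rootCoeff (Q : List (Fin n)) (I : Finset (Fin Q.length)) (i : I)
    (j : Fin Q.length) : ℝ :=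
  if h : Δ.RootConfigurationIsBasis Q I then
    (Module.Basis.mk h.1 h.2).repr (Δ.rootFunction Q I j) i
  else 0

/-- The coefficient `{i ‖ j}` computed in the cluster `I ∋ i`: `ρ_i(j)` if `j > i`, and `-ρ_i(j)`
if `j ≤ i`. -/
noncomputable def compatibilityDegree (Q : List (Fin n)) (I : Finset (Fin Q.length)) (i : I)
    (j : Fin Q.length) : ℝ :=
  if (i : Fin Q.length) < j then Δ.rootCoeff Q I i j else -Δ.rootCoeff Q I i j

end RootPairing.SimpleSystem

/-!
The proof moves between clusters by flips.

*Effect of a flip.* Inserting a letter at a position `a` into a subword multiplies all later partial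
products by the reflection through the root `γ` at `a` (`prefixProd_insert`). So exchanging a
position `a ∈ I` for a later `b ∉ I` carrying the same root `γ` keeps the product, turns the root
`γ` at `a` into the root `-γ` at `b`, and changes every other root by a multiple of `γ`
(`isFlip_of_rootFunction_eq`). The root configuration therefore remains a basis
(`IsFlip.isBasis`), and for `i ≠ a` the coordinate form at `i`, which vanishes on `γ`, is the same
for both bases and takes the same values on the roots `r(I, j)` (`IsFlip.rootCoeff_eq`).

*Connectedness.* If two clusters `I`, `J` first differ at `a`, with `a ∈ I` and `a ∉ J`, the exchange
condition provides a flip of `a` in `I`, after which the clusters agree up to and including `a`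
(`IsCluster.exists_exchange`). The positions common to `I` and `J` are not touched. Iterating, any
two clusters are joined by flips fixing their intersection
(`IsCluster.isBasis_iff_and_rootCoeff_eq`), so the coefficients at a common position agree, as
does the property that the root configuration is a basis.

*A starting point.* For `Q = c w`, the positions of `c` form a cluster whose root configuration
consists of the simple roots, because a reduced expression of a Coxeter element uses each letter
exactly once (`mem_and_length_eq_of_isCoxeterElement`, `exists_isCluster_isBasis`).
-/

namespace RootPairing.SimpleSystem

section Roots

variable {ι V N : Type*} [AddCommGroup V] [Module ℝ V] [AddCommGroup N] [Module ℝ N]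
  {P : RootPairing ι ℝ V N} {n : ℕ} (Δ : P.SimpleSystem n)

/-! ### Simple roots, signs of roots, and reflections -/

lemma span_simpleRoot [P.IsRootSystem] : ⊤ ≤ Submodule.span ℝ (Set.range Δ.simpleRoot) := by
  rw [← IsRootSystem.span_root_eq_top (P := P), Submodule.span_le]
  rintro _ ⟨k, rfl⟩
  obtain ⟨a, ha, -⟩ := Δ.nonneg_or_nonpos k
  rw [ha]
  exact Submodule.sum_mem _ fun s _ =>
    Submodule.smul_mem _ _ (Submodule.subset_span (Set.mem_range_self s))

/-- The simple roots, as a basis of `V`. -/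
noncomputable def simpleBasis [P.IsRootSystem] : Module.Basis (Fin n) ℝ V :=
  Module.Basis.mk Δ.linearIndependent Δ.span_simpleRoot

@[simp]
lemma simpleBasis_apply [P.IsRootSystem] (s : Fin n) : Δ.simpleBasis s = Δ.simpleRoot s :=
  Module.Basis.mk_apply _ _ s

lemma simpleBasis_repr_simpleRoot [P.IsRootSystem] (s t : Fin n) :
    Δ.simpleBasis.repr (Δ.simpleRoot s) t = if s = t then 1 else 0 := by
  rw [← simpleBasis_apply, Module.Basis.repr_self, Finsupp.single_apply]

/-- A vector is nonnegative if all its coordinates on the simple roots are nonnegative. A root is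
nonnegative exactly when it is a positive root. -/
def IsNonneg [P.IsRootSystem] (x : V) : Prop := ∀ s, 0 ≤ Δ.simpleBasis.repr x s

lemma isNonneg_or_isNonneg_neg [P.IsRootSystem] (k : ι) :
    Δ.IsNonneg (P.root k) ∨ Δ.IsNonneg (-P.root k) := by
  obtain ⟨a, ha, h⟩ := Δ.nonneg_or_nonpos k
  have hr : ∀ s, Δ.simpleBasis.repr (P.root k) s = a s := fun s => by
    have : P.root k = ∑ s, a s • Δ.simpleBasis s := by simpa [simpleRoot] using ha
    rw [this, Module.Basis.repr_sum_self]
  rcases h with h | h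
  · exact Or.inl fun s => by rw [hr]; exact h s
  · exact Or.inr fun s => by simpa [hr] using h s

lemma not_isNonneg_neg [P.IsRootSystem] {k : ι} (h : Δ.IsNonneg (P.root k)) :
    ¬ Δ.IsNonneg (-P.root k) := by
  intro h'
  apply P.ne_zero k
  apply Δ.simpleBasis.repr.injective
  ext s
  have h1 := h s
  have h2 := h' s
  simp only [map_neg, Finsupp.neg_apply] at h2
  simp only [map_zero, Finsupp.zero_apply]
  linarith

lemma isNonneg_simpleRoot [P.IsRootSystem] (s : Fin n) : Δ.IsNonneg (Δ.simpleRoot s) := by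
  intro t
  rw [simpleBasis_repr_simpleRoot]
  split_ifs <;> norm_num

lemma simpleBasis_repr_simpleReflection [P.IsRootSystem] {s t : Fin n} (h : s ≠ t) (x : V) :
    Δ.simpleBasis.repr (Δ.simpleReflection s x) t = Δ.simpleBasis.repr x t := by
  have : Δ.simpleReflection s x = x - P.coroot' (Δ.idx s) x • Δ.simpleRoot s := rfl
  rw [this, map_sub, map_smul, Finsupp.sub_apply, Finsupp.smul_apply,
    simpleBasis_repr_simpleRoot, if_neg h, smul_zero, sub_zero]

/-- A simple reflection makes only one positive root negative: the corresponding simple root. -/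
lemma root_eq_simpleRoot [P.IsRootSystem] [P.IsReduced] {k : ι} {s : Fin n}
    (h : Δ.IsNonneg (P.root k)) (h' : Δ.IsNonneg (-Δ.simpleReflection s (P.root k))) :
    P.root k = Δ.simpleRoot s := by
  have h0 : ∀ t, s ≠ t → Δ.simpleBasis.repr (P.root k) t = 0 := fun t ht => by
    have h1 := h t
    have h2 := h' t
    rw [map_neg, Finsupp.neg_apply, simpleBasis_repr_simpleReflection _ ht] at h2
    linarith
  have hk : P.root k = Δ.simpleBasis.repr (P.root k) s • P.root (Δ.idx s) := by
    change _ = _ • Δ.simpleRoot s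
    apply Δ.simpleBasis.repr.injective
    ext t
    rw [map_smul, Finsupp.smul_apply, simpleBasis_repr_simpleRoot]
    split_ifs with hst
    · simp [hst]
    · simp [h0 t hst]
  have hdep : ¬ LinearIndependent ℝ ![P.root k, P.root (Δ.idx s)] := by
    rw [LinearIndependent.pair_iff]
    intro hl
    have := (hl 1 (-Δ.simpleBasis.repr (P.root k) s) (by
      rw [one_smul, neg_smul, ← hk, add_neg_cancel])).1
    norm_num at this
  rcases IsReduced.eq_or_eq_neg k (Δ.idx s) hdep with h1 | h1
  · exact h1
  · exact absurd (Δ.isNonneg_simpleRoot s) (by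
      have := Δ.not_isNonneg_neg h
      rwa [h1, neg_neg] at this)

@[simp]
lemma wordProd_nil : Δ.wordProd [] = 1 := rfl

@[simp]
lemma wordProd_cons (s : Fin n) (ω : List (Fin n)) :
    Δ.wordProd (s :: ω) = Δ.simpleReflection s * Δ.wordProd ω := by
  simp [wordProd]

@[simp]
lemma wordProd_append (ω ω' : List (Fin n)) :
    Δ.wordProd (ω ++ ω') = Δ.wordProd ω * Δ.wordProd ω' := by
  simp [wordProd]

lemma wordProd_inv (ω : List (Fin n)) : (Δ.wordProd ω)⁻¹ = Δ.wordProd ω.reverse := by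
  have : ∀ s, (Δ.simpleReflection s)⁻¹ = Δ.simpleReflection s := fun s =>
    P.reflection_inv (Δ.idx s)
  induction ω with
  | nil => simp
  | cons s ω ih => simp [mul_inv_rev, ih, this]

/-- The group generated by the simple reflections permutes the roots, and conjugates the reflection
through a root into the reflection through its image. -/
lemma exists_root_eq_wordProd (ω : List (Fin n)) (k : ι) :
    ∃ l, P.root l = Δ.wordProd ω (P.root k) ∧
      P.reflection l = Δ.wordProd ω * P.reflection k * (Δ.wordProd ω)⁻¹ := by
  induction ω with
  | nil => exact ⟨k, by simp⟩
  | cons s ω ih =>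
    obtain ⟨l, h1, h2⟩ := ih
    refine ⟨P.reflectionPerm (Δ.idx s) l, ?_, ?_⟩
    · rw [root_reflectionPerm, h1, wordProd_cons]; rfl
    · rw [reflection_reflectionPerm, h2, wordProd_cons, mul_inv_rev, simpleReflection,
        P.reflection_inv]
      group

/-- A word without the letter `t` does not change the coordinate on `α_t`. -/
lemma simpleBasis_repr_wordProd [P.IsRootSystem] {t : Fin n} {ω : List (Fin n)} (h : t ∉ ω)
    (x : V) : Δ.simpleBasis.repr (Δ.wordProd ω x) t = Δ.simpleBasis.repr x t := by
  induction ω with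
  | nil => rfl
  | cons s ω ih =>
    rw [List.mem_cons, not_or] at h
    rw [wordProd_cons, LinearEquiv.mul_apply,
      simpleBasis_repr_simpleReflection _ (Ne.symm h.1), ih h.2]

lemma length_le (ω : List (Fin n)) : Δ.length (Δ.wordProd ω) ≤ ω.length :=
  Nat.sInf_le ⟨ω, rfl, rfl⟩

/-- If `l` and `c` spell the same element and `l` has no repeated letter, every letter of `l` occurs
in `c`. -/
lemma mem_of_wordProd_eq [P.IsRootSystem] {l c : List (Fin n)} (hl : l.Nodup) {t : Fin n}
    (ht : t ∈ l) (h : Δ.wordProd l = Δ.wordProd c) : t ∈ c := by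
  by_contra hc
  obtain ⟨A, B, rfl⟩ := List.append_of_mem ht
  have hAB : t ∉ A ∧ t ∉ B := by
    have := List.nodup_middle.1 hl
    simpa using (List.nodup_cons.1 this).1
  -- The vector `B⁻¹ α_t` has coordinate `1` on `α_t`, and its image under `l` has coordinate `-1`.
  set v := (Δ.wordProd B)⁻¹ (Δ.simpleRoot t) with hv
  have hBv : Δ.wordProd B v = Δ.simpleRoot t := by
    rw [hv, ← LinearEquiv.mul_apply, mul_inv_cancel]; rfl
  have h1 : Δ.simpleBasis.repr v t = 1 := by
    rw [← Δ.simpleBasis_repr_wordProd hAB.2, hBv, simpleBasis_repr_simpleRoot, if_pos rfl]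
  have h2 : Δ.simpleBasis.repr (Δ.wordProd (A ++ t :: B) v) t = -1 := by
    have : Δ.simpleReflection t (Δ.simpleRoot t) = -Δ.simpleRoot t :=
      P.reflection_apply_self (Δ.idx t)
    rw [wordProd_append, wordProd_cons, LinearEquiv.mul_apply, LinearEquiv.mul_apply, hBv,
      simpleBasis_repr_wordProd _ hAB.1, this, map_neg, Finsupp.neg_apply,
      simpleBasis_repr_simpleRoot, if_pos rfl]
  rw [h, simpleBasis_repr_wordProd _ hc, h1] at h2
  norm_num at h2

/-- A reduced expression of a Coxeter element contains each of the `n` letters, and has length `n`,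
so it contains each letter exactly once. -/
lemma mem_and_length_eq_of_isCoxeterElement [P.IsRootSystem] {c : List (Fin n)}
    (hc : Δ.IsCoxeterElement (Δ.wordProd c)) (hc' : Δ.IsReducedExpr c (Δ.wordProd c)) :
    (∀ s, s ∈ c) ∧ c.length = n := by
  obtain ⟨l, hl, hmem, h⟩ := hc
  have hcm : ∀ s, s ∈ c := fun s => Δ.mem_of_wordProd_eq hl (hmem s) h
  refine ⟨hcm, le_antisymm ?_ ?_⟩
  · rw [hc'.2, ← h]
    refine (Δ.length_le l).trans ?_
    simpa using hl.length_le_card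
  · have : Finset.univ ⊆ c.toFinset := fun s _ => by simpa using hcm s
    simpa using (Finset.card_le_card this).trans c.toFinset_card_le

end Roots

section Subwords

variable {n : ℕ} {Q : List (Fin n)}

/-! ### Subwords -/

lemma length_subword (X : Finset (Fin Q.length)) : (subword Q X).length = X.card := by
  have h : ((List.finRange Q.length).filter (· ∈ X)).toFinset = X := by ext; simp
  rw [subword, List.length_map, ← List.toFinset_card_of_nodup
    ((List.nodup_finRange _).filter _), h]

lemma subword_union {A B : Finset (Fin Q.length)} (h : ∀ a ∈ A, ∀ b ∈ B, a < b) :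
    subword Q (A ∪ B) = subword Q A ++ subword Q B := by
  rw [subword, subword, subword, ← List.map_append]
  congr 1
  have hs : ∀ X : Finset (Fin Q.length),
      ((List.finRange Q.length).filter (· ∈ X)).Pairwise (· < ·) := fun X =>
    (List.pairwise_lt_finRange _).filter _
  have hp : ((List.finRange Q.length).filter (· ∈ A) ++
      (List.finRange Q.length).filter (· ∈ B)).Pairwise (· < ·) := by
    rw [List.pairwise_append]
    exact ⟨hs A, hs B, fun a ha b hb => h a (by simpa using ha) b (by simpa using hb)⟩
  refine List.Perm.eq_of_pairwise' (r := (· < ·)) (hs _) hp ?_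
  rw [List.perm_ext_iff_of_nodup ((hs _).imp ne_of_lt) (hp.imp ne_of_lt)]
  intro x
  simp

lemma subword_singleton (a : Fin Q.length) : subword Q {a} = [Q.get a] := by
  have h : (List.finRange Q.length).filter (· ∈ ({a} : Finset (Fin Q.length))) = [a] := by
    have := (List.nodup_finRange Q.length).filter (· ∈ ({a} : Finset (Fin Q.length)))
    rw [← List.perm_singleton, List.perm_ext_iff_of_nodup this (List.nodup_singleton a)]
    simp
  rw [subword, h, List.map_singleton]

end Subwords

section PartialProducts

variable {ι V N : Type*} [AddCommGroup V] [Module ℝ V] [AddCommGroup N] [Module ℝ N]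
  {P : RootPairing ι ℝ V N} {n : ℕ} (Δ : P.SimpleSystem n) {Q : List (Fin n)}

/-! ### Partial products of a subword -/

/-- The product, in order, of the letters of `Q` at the positions `x < j` of `X`. The bound `j` is
a natural number, so that `j = Q.length` gives the product over all of `X`. -/
def prefixProd (Q : List (Fin n)) (X : Finset (Fin Q.length)) (j : ℕ) : V ≃ₗ[ℝ] V :=
  Δ.wordProd (subword Q (X.filter fun x : Fin Q.length => (x : ℕ) < j))

/-- The root function, in terms of the complement `X` of a set of positions. -/
def rootAt (Q : List (Fin n)) (X : Finset (Fin Q.length)) (a : Fin Q.length) : V :=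
  Δ.prefixProd Q X a (Δ.simpleRoot (Q.get a))

lemma rootFunction_eq_rootAt (I : Finset (Fin Q.length)) (j : Fin Q.length) :
    Δ.rootFunction Q I j = Δ.rootAt Q Iᶜ j := by
  have : Finset.Iio j \ I = Iᶜ.filter fun x : Fin Q.length => (x : ℕ) < j := by
    ext x; simp [and_comm]
  rw [rootFunction, rootAt, prefixProd, this]

lemma prefixProd_length (X : Finset (Fin Q.length)) :
    Δ.prefixProd Q X Q.length = Δ.wordProd (subword Q X) := by
  rw [prefixProd, Finset.filter_true_of_mem fun x _ => x.2]

lemma isCluster_iff {w₀ : V ≃ₗ[ℝ] V} {I : Finset (Fin Q.length)} :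
    Δ.IsCluster w₀ Q I ↔ Δ.prefixProd Q Iᶜ Q.length = w₀ ∧ Iᶜ.card = Δ.length w₀ := by
  rw [IsCluster, IsReducedExpr, prefixProd_length, length_subword]

lemma prefixProd_congr {X Y : Finset (Fin Q.length)} {j : ℕ}
    (h : ∀ x : Fin Q.length, (x : ℕ) < j → (x ∈ X ↔ x ∈ Y)) :
    Δ.prefixProd Q X j = Δ.prefixProd Q Y j := by
  have : (X.filter fun x : Fin Q.length => (x : ℕ) < j) = Y.filter fun x : Fin Q.length => (x : ℕ) < j := by
    ext x
    simp only [Finset.mem_filter]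
    exact and_congr_left (h x)
  rw [prefixProd, this, prefixProd]

lemma rootAt_congr {X Y : Finset (Fin Q.length)} {a : Fin Q.length}
    (h : ∀ x < a, (x ∈ X ↔ x ∈ Y)) : Δ.rootAt Q X a = Δ.rootAt Q Y a := by
  rw [rootAt, rootAt, Δ.prefixProd_congr fun x hx => h x hx]

lemma prefixProd_succ_of_mem {X : Finset (Fin Q.length)} {a : Fin Q.length} (h : a ∈ X) :
    Δ.prefixProd Q X (a + 1) = Δ.prefixProd Q X a * Δ.simpleReflection (Q.get a) := by
  have : (X.filter fun x : Fin Q.length => (x : ℕ) < a + 1) = (X.filter fun x : Fin Q.length => (x : ℕ) < a) ∪ {a} := by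
    ext x
    simp only [Finset.mem_filter, Finset.mem_union, Finset.mem_singleton]
    constructor
    · rintro ⟨hx, h1⟩
      rcases Nat.lt_succ_iff_lt_or_eq.1 h1 with h2 | h2
      · exact Or.inl ⟨hx, h2⟩
      · exact Or.inr (Fin.ext h2)
    · rintro (⟨hx, h1⟩ | rfl)
      · exact ⟨hx, by omega⟩
      · exact ⟨h, by omega⟩
  rw [prefixProd, this, subword_union, wordProd_append, subword_singleton]
  · simp [prefixProd]
  · intro x hx b hb
    rw [Finset.mem_singleton.1 hb]
    exact (Finset.mem_filter.1 hx).2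

lemma prefixProd_succ_of_notMem {X : Finset (Fin Q.length)} {a : Fin Q.length} (h : a ∉ X) :
    Δ.prefixProd Q X (a + 1) = Δ.prefixProd Q X a := by
  have : (X.filter fun x : Fin Q.length => (x : ℕ) < a + 1) = X.filter fun x : Fin Q.length => (x : ℕ) < a := by
    refine Finset.filter_congr fun x hx => ?_
    have : (x : ℕ) ≠ a := fun e => h (Fin.ext e ▸ hx)
    omega
  rw [prefixProd, this, prefixProd]

lemma exists_root_eq_rootAt (X : Finset (Fin Q.length)) (a : Fin Q.length) :
    ∃ k, P.root k = Δ.rootAt Q X a := by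
  obtain ⟨k, hk, -⟩ := Δ.exists_root_eq_wordProd
    (subword Q (X.filter fun x : Fin Q.length => (x : ℕ) < a)) (Δ.idx (Q.get a))
  exact ⟨k, hk⟩

lemma reflection_mul_prefixProd {X : Finset (Fin Q.length)} {a : Fin Q.length} {k : ι}
    (hk : P.root k = Δ.rootAt Q X a) :
    P.reflection k * Δ.prefixProd Q X a =
      Δ.prefixProd Q X a * Δ.simpleReflection (Q.get a) := by
  obtain ⟨l, hl, hl'⟩ := Δ.exists_root_eq_wordProd
    (subword Q (X.filter fun x : Fin Q.length => (x : ℕ) < a)) (Δ.idx (Q.get a))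
  have : k = l := P.root.injective (hk.trans hl.symm)
  rw [this, hl', prefixProd, simpleReflection]
  group

/-- Inserting a position `a` into a subword leaves the partial products up to `a` unchanged, and
multiplies the later ones on the left by the reflection through the root at `a`. -/
lemma prefixProd_insert {Y : Finset (Fin Q.length)} {a : Fin Q.length} (ha : a ∉ Y) {k : ι}
    (hk : P.root k = Δ.rootAt Q Y a) {j : ℕ} (hj : j ≤ Q.length) :
    Δ.prefixProd Q (insert a Y) j =
      if (a : ℕ) < j then P.reflection k * Δ.prefixProd Q Y j else Δ.prefixProd Q Y j := by
  split_ifs with haj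
  · induction j, (show (a : ℕ) + 1 ≤ j from haj) using Nat.le_induction with
    | base =>
      rw [Δ.prefixProd_succ_of_mem (Finset.mem_insert_self a Y), Δ.prefixProd_succ_of_notMem ha,
        Δ.reflection_mul_prefixProd hk]
      congr 1
      exact Δ.prefixProd_congr fun x hx => by
        rw [Finset.mem_insert, or_iff_right (fun e => by rw [e] at hx; omega)]
    | succ j hj' ih =>
      set b : Fin Q.length := ⟨j, hj⟩
      have hb : b ∈ insert a Y ↔ b ∈ Y := by
        rw [Finset.mem_insert, or_iff_right (fun e => by rw [← e] at hj'; simp [b] at hj')]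
      have ih' := ih (by omega) (by omega)
      change Δ.prefixProd Q _ (b + 1) = _ * Δ.prefixProd Q _ (b + 1)
      by_cases hbY : b ∈ Y
      · rw [Δ.prefixProd_succ_of_mem hbY, Δ.prefixProd_succ_of_mem (hb.2 hbY), ← mul_assoc]
        exact congrArg (· * _) ih'
      · rw [Δ.prefixProd_succ_of_notMem hbY, Δ.prefixProd_succ_of_notMem (fun h => hbY (hb.1 h))]
        exact ih'
  · exact Δ.prefixProd_congr fun x hx => by
      rw [Finset.mem_insert, or_iff_right (fun e => by rw [e] at hx; omega)]

lemma prefixProd_insert_length {Y : Finset (Fin Q.length)} {a : Fin Q.length} (ha : a ∉ Y) {k : ι}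
    (hk : P.root k = Δ.rootAt Q Y a) :
    Δ.prefixProd Q (insert a Y) Q.length = P.reflection k * Δ.prefixProd Q Y Q.length := by
  rw [Δ.prefixProd_insert ha hk le_rfl, if_pos a.2]

/-- Inserting a position `a` changes every root only by a multiple of the root at `a`. -/
lemma exists_rootAt_insert {Y : Finset (Fin Q.length)} {a : Fin Q.length} (ha : a ∉ Y)
    (j : Fin Q.length) :
    ∃ x : ℝ, Δ.rootAt Q (insert a Y) j = Δ.rootAt Q Y j + x • Δ.rootAt Q Y a := by
  obtain ⟨k, hk⟩ := Δ.exists_root_eq_rootAt Y a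
  rw [rootAt, Δ.prefixProd_insert ha hk j.2.le]
  split_ifs
  · refine ⟨-P.coroot' k (Δ.rootAt Q Y j), ?_⟩
    rw [LinearEquiv.mul_apply, reflection_apply, hk, neg_smul, ← sub_eq_add_neg]
    rfl
  · exact ⟨0, by rw [zero_smul, add_zero]; rfl⟩

/-! ### The exchange condition -/

/-- If the inverse of the product of the subword `X` makes the root `γ` at a position `a` of the
complement negative, then `γ` occurs again at a later position of `X`. It is the position where the
image of `γ` under the inverses of the partial products turns negative. -/
lemma exists_rootAt_eq [P.IsRootSystem] [P.IsReduced] {X : Finset (Fin Q.length)}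
    {a : Fin Q.length} (ha : a ∉ X)
    (h : Δ.IsNonneg (-(Δ.prefixProd Q X Q.length)⁻¹ (Δ.rootAt Q X a))) :
    ∃ b ∈ X, a < b ∧ Δ.rootAt Q X b = Δ.rootAt Q X a := by
  by_contra! hne
  obtain ⟨k, hk⟩ := Δ.exists_root_eq_rootAt X a
  have hroot : ∀ j, ∃ l, P.root l = (Δ.prefixProd Q X j)⁻¹ (Δ.rootAt Q X a) := fun j => by
    rw [prefixProd, wordProd_inv, ← hk]
    obtain ⟨l, hl, -⟩ := Δ.exists_root_eq_wordProd
      (subword Q (X.filter fun x : Fin Q.length => (x : ℕ) < j)).reverse k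
    exact ⟨l, hl⟩
  have hpos : ∀ j, (a : ℕ) ≤ j → j ≤ Q.length →
      Δ.IsNonneg ((Δ.prefixProd Q X j)⁻¹ (Δ.rootAt Q X a)) := by
    intro j hj
    induction j, hj using Nat.le_induction with
    | base =>
      intro _
      rw [rootAt, ← LinearEquiv.mul_apply, inv_mul_cancel]
      exact Δ.isNonneg_simpleRoot _
    | succ j hj ih =>
      intro hjQ
      have ih' := ih (by omega)
      set b : Fin Q.length := ⟨j, hjQ⟩
      change Δ.IsNonneg ((Δ.prefixProd Q X (b + 1))⁻¹ (Δ.rootAt Q X a))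
      change Δ.IsNonneg ((Δ.prefixProd Q X b)⁻¹ (Δ.rootAt Q X a)) at ih'
      by_cases hb : b ∈ X
      · have hab : a < b :=
          lt_of_le_of_ne hj fun e => ha (by rwa [e])
        have hs : (Δ.prefixProd Q X (b + 1))⁻¹ (Δ.rootAt Q X a) =
            Δ.simpleReflection (Q.get b) ((Δ.prefixProd Q X b)⁻¹ (Δ.rootAt Q X a)) := by
          rw [Δ.prefixProd_succ_of_mem hb, mul_inv_rev, LinearEquiv.mul_apply]; rfl
        obtain ⟨l, hl⟩ := hroot b
        obtain ⟨l', hl'⟩ := hroot (b + 1)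
        rw [← hl']
        refine (Δ.isNonneg_or_isNonneg_neg l').resolve_right fun hneg => hne b hb hab ?_
        rw [← hl] at ih' hs
        rw [hl', hs] at hneg
        rw [rootAt, ← Δ.root_eq_simpleRoot ih' hneg, hl, ← LinearEquiv.mul_apply, mul_inv_cancel]
        rfl
      · rwa [Δ.prefixProd_succ_of_notMem hb]
  obtain ⟨l, hl⟩ := hroot Q.length
  have := hpos Q.length a.2.le le_rfl
  rw [← hl] at h this
  exact Δ.not_isNonneg_neg this h

lemma compl_insert_erase {α : Type*} [Fintype α] [DecidableEq α] {I : Finset α} {a b : α}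
    (hab : a ≠ b) : (insert b (I.erase a))ᶜ = insert a (Iᶜ.erase b) := by
  ext x
  by_cases hx : x = a
  · simp [hx, hab]
  · simp [hx]

/-- If two clusters agree before `a`, and `a` lies in the first but not in the second, then `a` can
be exchanged in the first cluster for a later position `b` carrying the same root. -/
lemma IsCluster.exists_exchange [P.IsRootSystem] [P.IsReduced] {w₀ : V ≃ₗ[ℝ] V}
    {I J : Finset (Fin Q.length)} (hI : Δ.IsCluster w₀ Q I) (hJ : Δ.IsCluster w₀ Q J)
    {a : Fin Q.length} (hIJ : ∀ x < a, (x ∈ I ↔ x ∈ J)) (haI : a ∈ I) (haJ : a ∉ J) :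
    ∃ b ∉ I, a < b ∧ Δ.rootFunction Q I b = Δ.rootFunction Q I a ∧
      Δ.IsCluster w₀ Q (insert b (I.erase a)) := by
  rw [isCluster_iff] at hI hJ
  obtain ⟨k, hk⟩ := Δ.exists_root_eq_rootAt Iᶜ a
  have hself : P.reflection k * P.reflection k = 1 := by
    ext x; simp
  have haI' : a ∉ Iᶜ := by simpa using haI
  have hneg : Δ.IsNonneg (-w₀⁻¹ (P.root k)) := by
    -- Otherwise two letters can be deleted from the reduced subword on the complement of `J`.
    by_contra hpos
    set Y := Jᶜ.erase a with hYdef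
    have hJY : Jᶜ = insert a Y := (Finset.insert_erase (by simpa using haJ)).symm
    have haY : a ∉ Y := Finset.notMem_erase a _
    have hkY : P.root k = Δ.rootAt Q Y a := hk.trans <| Δ.rootAt_congr fun x hx => by
      simp [hYdef, hx.ne, hIJ x hx]
    have hw : w₀ = P.reflection k * Δ.prefixProd Q Y Q.length := by
      rw [← hJ.1, hJY, Δ.prefixProd_insert_length haY hkY]
    have hinv : (Δ.prefixProd Q Y Q.length)⁻¹ (Δ.rootAt Q Y a) = -w₀⁻¹ (P.root k) := by
      rw [← hkY, hw, mul_inv_rev, P.reflection_inv, LinearEquiv.mul_apply, reflection_apply_self,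
        map_neg, neg_neg]
    obtain ⟨l, hl⟩ : ∃ l, P.root l = w₀⁻¹ (P.root k) := by
      rw [← hI.1, prefixProd, wordProd_inv]
      obtain ⟨l, hl, -⟩ := Δ.exists_root_eq_wordProd (subword Q
        (Iᶜ.filter fun x : Fin Q.length => (x : ℕ) < Q.length)).reverse k
      exact ⟨l, hl⟩
    obtain ⟨b, hbY, hab, hb⟩ := Δ.exists_rootAt_eq haY (by
      rw [hinv, neg_neg, ← hl]
      rw [← hl] at hpos
      exact (Δ.isNonneg_or_isNonneg_neg l).resolve_right hpos)
    have hkb : P.root k = Δ.rootAt Q (Y.erase b) b :=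
      hkY.trans <| hb.symm.trans <| Δ.rootAt_congr fun x hx => by simp [hx.ne]
    have hw' : w₀ = Δ.wordProd (subword Q (Y.erase b)) := by
      rw [hw, ← Finset.insert_erase hbY,
        Δ.prefixProd_insert_length (Finset.notMem_erase b Y) hkb, ← mul_assoc, hself, one_mul,
        prefixProd_length, Finset.erase_insert (Finset.notMem_erase b Y)]
    have hlen := Δ.length_le (subword Q (Y.erase b))
    rw [← hw', ← hJ.2, length_subword, Finset.card_erase_of_mem hbY, hJY,
      Finset.card_insert_of_notMem haY] at hlen
    omega
  obtain ⟨b, hbX, hab, hb⟩ := Δ.exists_rootAt_eq haI' (by rwa [hI.1, ← hk])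
  refine ⟨b, by simpa using hbX, hab, by rwa [rootFunction_eq_rootAt, rootFunction_eq_rootAt], ?_⟩
  have hka : P.root k = Δ.rootAt Q (Iᶜ.erase b) a :=
    hk.trans <| Δ.rootAt_congr fun x hx => by simp [(hx.trans hab).ne]
  have hkb : P.root k = Δ.rootAt Q (Iᶜ.erase b) b :=
    hk.trans <| hb.symm.trans <| Δ.rootAt_congr fun x hx => by simp [hx.ne]
  have haY : a ∉ Iᶜ.erase b := fun h => haI' (Finset.mem_of_mem_erase h)
  rw [isCluster_iff, compl_insert_erase hab.ne, Δ.prefixProd_insert_length haY hka,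
    Finset.card_insert_of_notMem haY, Finset.card_erase_add_one hbX]
  refine ⟨?_, hI.2⟩
  rw [← hI.1, ← Δ.prefixProd_insert_length (Finset.notMem_erase b _) hkb,
    Finset.insert_erase hbX]

end PartialProducts

section Clusters

variable {ι V N : Type*} [AddCommGroup V] [Module ℝ V] [AddCommGroup N] [Module ℝ N]
  {P : RootPairing ι ℝ V N} {n : ℕ} (Δ : P.SimpleSystem n) {Q : List (Fin n)}

/-! ### Flips -/

/-- The set `I'` is obtained from `I` by a flip: a position `a` of `I` is replaced by a position
`b` outside `I`, the root at `b` becomes the opposite of the root at `a`, and all roots change by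
multiples of that root only. Only this effect on the root function is recorded, which makes the
relation symmetric. -/
def IsFlip (Q : List (Fin n)) (I I' : Finset (Fin Q.length)) : Prop :=
  ∃ a ∈ I, ∃ b ∉ I, I' = insert b (I.erase a) ∧
    Δ.rootFunction Q I' b = -Δ.rootFunction Q I a ∧
    ∀ j, ∃ x : ℝ, Δ.rootFunction Q I' j = Δ.rootFunction Q I j + x • Δ.rootFunction Q I a

variable {Δ}

lemma IsFlip.symm {I I' : Finset (Fin Q.length)} (h : Δ.IsFlip Q I I') : Δ.IsFlip Q I' I := by
  obtain ⟨a, ha, b, hb, rfl, hab, hj⟩ := h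
  have hne : a ≠ b := fun e => hb (e ▸ ha)
  refine ⟨b, Finset.mem_insert_self _ _, a, by simp [hne], ?_, by rw [hab, neg_neg], fun j => ?_⟩
  · rw [Finset.erase_insert fun h => hb (Finset.mem_of_mem_erase h), Finset.insert_erase ha]
  · obtain ⟨x, hx⟩ := hj j
    exact ⟨x, by rw [hx, hab]; module⟩

lemma IsFlip.isBasis {I I' : Finset (Fin Q.length)} (h : Δ.IsFlip Q I I')
    (hI : Δ.RootConfigurationIsBasis Q I) : Δ.RootConfigurationIsBasis Q I' := by
  have hspan : ⊤ ≤ Submodule.span ℝ (Set.range (Δ.rootConfiguration Q I')) := by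
    refine hI.2.trans (Submodule.span_le.2 ?_)
    obtain ⟨a, ha, b, hb, rfl, hab, hj⟩ := h
    have hmem : ∀ l ∈ insert b (I.erase a), Δ.rootFunction Q (insert b (I.erase a)) l ∈
        Submodule.span ℝ (Set.range (Δ.rootConfiguration Q (insert b (I.erase a)))) :=
      fun l hl => Submodule.subset_span ⟨⟨l, hl⟩, rfl⟩
    have hra : Δ.rootFunction Q I a ∈
        Submodule.span ℝ (Set.range (Δ.rootConfiguration Q (insert b (I.erase a)))) := by
      rw [← Submodule.neg_mem_iff, ← hab]
      exact hmem b (Finset.mem_insert_self _ _)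
    rintro _ ⟨⟨l, hl⟩, rfl⟩
    change Δ.rootFunction Q I l ∈ _
    by_cases hla : l = a
    · rwa [hla]
    · obtain ⟨x, hx⟩ := hj l
      rw [eq_sub_of_add_eq hx.symm]
      exact Submodule.sub_mem _ (hmem l (by simp [hla, hl])) (Submodule.smul_mem _ _ hra)
  refine ⟨linearIndependent_of_top_le_span_of_card_eq_finrank hspan ?_, hspan⟩
  rw [Module.finrank_eq_card_basis (Module.Basis.mk hI.1 hI.2), Fintype.card_coe, Fintype.card_coe]
  obtain ⟨a, ha, b, hb, rfl, -⟩ := h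
  rw [Finset.card_insert_of_notMem fun h => hb (Finset.mem_of_mem_erase h),
    Finset.card_erase_add_one ha]

/-- A coefficient at a position that is not flipped does not change: the coordinate form at `i`
vanishes on the flipped root, so it is also the coordinate form at `i` of the new basis. -/
lemma IsFlip.rootCoeff_eq {I I' : Finset (Fin Q.length)} (h : Δ.IsFlip Q I I')
    {i : Fin Q.length} (hi : i ∈ I) (hi' : i ∈ I') (j : Fin Q.length) :
    Δ.rootCoeff Q I ⟨i, hi⟩ j = Δ.rootCoeff Q I' ⟨i, hi'⟩ j := by
  by_cases hI : Δ.RootConfigurationIsBasis Q I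
  swap
  · rw [rootCoeff, rootCoeff, dif_neg hI, dif_neg fun h' => hI (h.symm.isBasis h')]
  have hI' := h.isBasis hI
  rw [rootCoeff, rootCoeff, dif_pos hI, dif_pos hI']
  set φ := (Module.Basis.mk hI.1 hI.2).coord ⟨i, hi⟩ with hφ
  have hφI : ∀ l ∈ I, φ (Δ.rootFunction Q I l) = if l = i then 1 else 0 := fun l hl => by
    have : Δ.rootFunction Q I l = Module.Basis.mk hI.1 hI.2 ⟨l, hl⟩ := by
      rw [Module.Basis.mk_apply]; rfl
    rw [this, hφ, Module.Basis.coord_apply, Module.Basis.repr_self, Finsupp.single_apply]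
    simp only [Subtype.mk.injEq]
  obtain ⟨a, ha, b, hb, rfl, hab, hj⟩ := h
  have hib : i ≠ b := fun e => hb (e ▸ hi)
  have hia : i ≠ a := Finset.ne_of_mem_erase (Finset.mem_of_mem_insert_of_ne hi' hib)
  have hφa : φ (Δ.rootFunction Q I a) = 0 := by rw [hφI a ha, if_neg hia.symm]
  have hφj : ∀ l, φ (Δ.rootFunction Q (insert b (I.erase a)) l) = φ (Δ.rootFunction Q I l) :=
    fun l => by
      obtain ⟨x, hx⟩ := hj l
      rw [hx, map_add, map_smul, hφa, smul_zero, add_zero]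
  have hcoord : (Module.Basis.mk hI'.1 hI'.2).coord ⟨i, hi'⟩ = φ := by
    refine (Module.Basis.mk hI'.1 hI'.2).ext fun ⟨l, hl⟩ => ?_
    rw [Module.Basis.coord_apply, Module.Basis.repr_self, Finsupp.single_apply,
      Module.Basis.mk_apply]
    change _ = φ (Δ.rootFunction Q (insert b (I.erase a)) l)
    simp only [Subtype.mk.injEq]
    rcases Finset.mem_insert.1 hl with rfl | hl'
    · rw [if_neg hib.symm, hab, map_neg, hφa, neg_zero]
    · rw [hφj, hφI l (Finset.mem_of_mem_erase hl')]
  rw [← Module.Basis.coord_apply, ← Module.Basis.coord_apply, hcoord, hφj]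

lemma isFlip_of_rootFunction_eq {I : Finset (Fin Q.length)} {a b : Fin Q.length} (ha : a ∈ I)
    (hb : b ∉ I) (hab : a < b) (h : Δ.rootFunction Q I b = Δ.rootFunction Q I a) :
    Δ.IsFlip Q I (insert b (I.erase a)) := by
  have haI : a ∉ Iᶜ := by simpa using ha
  have hcompl := compl_insert_erase (I := I) hab.ne
  have haY : a ∉ Iᶜ.erase b := fun h => haI (Finset.mem_of_mem_erase h)
  have hIc : Iᶜ = insert b (Iᶜ.erase b) := (Finset.insert_erase (by simpa using hb)).symm
  have hYa : Δ.rootAt Q (Iᶜ.erase b) a = Δ.rootFunction Q I a := by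
    rw [rootFunction_eq_rootAt]
    exact Δ.rootAt_congr fun x hx => by simp [(hx.trans hab).ne]
  have hYb : Δ.rootAt Q (Iᶜ.erase b) b = Δ.rootFunction Q I a := by
    rw [← h, rootFunction_eq_rootAt]
    exact Δ.rootAt_congr fun x hx => by simp [hx.ne]
  refine ⟨a, ha, b, hb, rfl, ?_, fun j => ?_⟩
  · obtain ⟨k, hk⟩ := Δ.exists_root_eq_rootAt (Iᶜ.erase b) a
    rw [rootFunction_eq_rootAt, hcompl, rootAt, Δ.prefixProd_insert haY hk b.2.le,
      if_pos (Fin.lt_def.1 hab),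
      LinearEquiv.mul_apply]
    change P.reflection k (Δ.rootAt Q (Iᶜ.erase b) b) = _
    rw [hYb, ← hYa, ← hk, reflection_apply_self]
  · obtain ⟨x, hx⟩ := Δ.exists_rootAt_insert haY j
    obtain ⟨y, hy⟩ := Δ.exists_rootAt_insert (Finset.notMem_erase b Iᶜ) j
    refine ⟨x - y, ?_⟩
    rw [← hIc, hYb, ← rootFunction_eq_rootAt] at hy
    rw [rootFunction_eq_rootAt, hcompl, hx, hYa, hy]
    module

/-! ### Comparison of two clusters -/

/-- Two clusters are joined by flips that fix their common positions. The flips are found by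
making the clusters agree on longer and longer initial segments of positions. -/
lemma IsCluster.isBasis_iff_and_rootCoeff_eq [P.IsRootSystem] [P.IsReduced] {w₀ : V ≃ₗ[ℝ] V}
    {I J : Finset (Fin Q.length)} (hI : Δ.IsCluster w₀ Q I) (hJ : Δ.IsCluster w₀ Q J) :
    (Δ.RootConfigurationIsBasis Q I ↔ Δ.RootConfigurationIsBasis Q J) ∧
      ∀ (i : Fin Q.length) (hi : i ∈ I) (hi' : i ∈ J) (j : Fin Q.length),
        Δ.rootCoeff Q I ⟨i, hi⟩ j = Δ.rootCoeff Q J ⟨i, hi'⟩ j := by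
  suffices H : ∀ d k, k + d = Q.length → ∀ I J : Finset (Fin Q.length), Δ.IsCluster w₀ Q I →
      Δ.IsCluster w₀ Q J → (∀ x : Fin Q.length, (x : ℕ) < k → (x ∈ I ↔ x ∈ J)) →
      (Δ.RootConfigurationIsBasis Q I ↔ Δ.RootConfigurationIsBasis Q J) ∧
      ∀ (i : Fin Q.length) (hi : i ∈ I) (hi' : i ∈ J) (j : Fin Q.length),
        Δ.rootCoeff Q I ⟨i, hi⟩ j = Δ.rootCoeff Q J ⟨i, hi'⟩ j from
    H Q.length 0 (zero_add _) I J hI hJ fun x hx => absurd hx (Nat.not_lt_zero _)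
  clear hI hJ I J
  intro d
  induction d with
  | zero =>
    intro k hk I J _ _ hIJ
    obtain rfl : I = J := by
      ext x
      exact hIJ x (by omega)
    exact ⟨Iff.rfl, fun _ _ _ _ => rfl⟩
  | succ d ih =>
    intro k hk I J hI hJ hIJ
    have ih' := ih (k + 1) (by omega)
    set a : Fin Q.length := ⟨k, by omega⟩ with ha
    have hext : ∀ I J : Finset (Fin Q.length),
        (∀ x : Fin Q.length, (x : ℕ) < k → (x ∈ I ↔ x ∈ J)) → (a ∈ I ↔ a ∈ J) →
        ∀ x : Fin Q.length, (x : ℕ) < k + 1 → (x ∈ I ↔ x ∈ J) := by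
      intro I J hIJ haIJ x hx
      rcases Nat.lt_succ_iff_lt_or_eq.1 hx with h | h
      · exact hIJ x h
      · rwa [show x = a from Fin.ext h]
    by_cases haIJ : a ∈ I ↔ a ∈ J
    · exact ih' I J hI hJ (hext I J hIJ haIJ)
    wlog haI : a ∈ I generalizing I J
    · obtain ⟨h1, h2⟩ := this J I hJ hI (fun x hx => (hIJ x hx).symm) (fun h => haIJ h.symm)
        (by tauto)
      exact ⟨h1.symm, fun i hi hi' j => (h2 i hi' hi j).symm⟩
    have haJ : a ∉ J := by tauto
    obtain ⟨b, hb, hab, hroot, hI'⟩ := IsCluster.exists_exchange Δ hI hJ (a := a)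
      (fun x hx => hIJ x hx) haI haJ
    have hflip := isFlip_of_rootFunction_eq haI hb hab hroot
    obtain ⟨h1, h2⟩ := ih' _ J hI' hJ (hext _ J (fun x hx => by
        have hxa : x < a := hx
        rw [← hIJ x hx]
        simp [hxa.ne, (hxa.trans hab).ne]) (by simp [haJ, hab.ne]))
    refine ⟨⟨fun h => h1.1 (hflip.isBasis h), fun h => hflip.symm.isBasis (h1.2 h)⟩, ?_⟩
    intro i hi hi' j
    have hia : i ≠ a := fun e => haJ (e ▸ hi')
    have hiI' : i ∈ insert b (I.erase a) := by simp [hia, hi]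
    rw [hflip.rootCoeff_eq hi hiI', h2 i hiI' hi']

/-! ### The initial cluster -/

/-- In `Q = c w`, the positions of `c` form a cluster whose root configuration consists of the
simple roots. -/
lemma exists_isCluster_isBasis [P.IsRootSystem] {c w : List (Fin n)} {w₀ : V ≃ₗ[ℝ] V}
    (hc : ∀ s, s ∈ c) (hcn : c.length = n) (hw : Δ.IsReducedExpr w w₀) :
    ∃ I, Δ.IsCluster w₀ (c ++ w) I ∧ Δ.RootConfigurationIsBasis (c ++ w) I := by
  set I : Finset (Fin (c ++ w).length) := Finset.univ.filter fun x => (x : ℕ) < c.length with hIdef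
  have hcw : (c ++ w).length = c.length + w.length := List.length_append
  have hcard : I.card = c.length := by
    rw [hIdef, Fin.card_filter_val_lt]
    omega
  have hsub : subword (c ++ w) I ++ subword (c ++ w) Iᶜ = c ++ w := by
    rw [← subword_union, Finset.union_compl]
    · simp [subword]
    · intro a ha b hb
      simp only [hIdef, Finset.mem_filter, Finset.mem_compl, Finset.mem_univ, true_and] at ha hb
      exact Fin.lt_def.2 (by omega)
  have hsub' : subword (c ++ w) Iᶜ = w :=
    (List.append_inj hsub (by rw [length_subword, hcard])).2
  have hspan : ⊤ ≤ Submodule.span ℝ (Set.range (Δ.rootConfiguration (c ++ w) I)) := by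
    refine Δ.span_simpleRoot.trans (Submodule.span_mono ?_)
    rintro _ ⟨s, rfl⟩
    obtain ⟨k, hk, rfl⟩ := List.getElem_of_mem (hc s)
    have hkI : (⟨k, by omega⟩ : Fin (c ++ w).length) ∈ I := by simpa [hIdef] using hk
    refine ⟨⟨_, hkI⟩, ?_⟩
    have hempty : Finset.Iio (⟨k, by omega⟩ : Fin (c ++ w).length) \ I = ∅ := by
      refine Finset.sdiff_eq_empty_iff_subset.2 fun x hx => ?_
      have : (x : ℕ) < k := Fin.lt_def.1 (Finset.mem_Iio.1 hx)
      simp only [hIdef, Finset.mem_filter, Finset.mem_univ, true_and]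
      omega
    rw [rootConfiguration, rootFunction, hempty]
    simp [subword, List.getElem_append_left hk]
  refine ⟨I, by rwa [IsCluster, hsub'],
    linearIndependent_of_top_le_span_of_card_eq_finrank hspan ?_, hspan⟩
  rw [Module.finrank_eq_card_basis Δ.simpleBasis, Fintype.card_coe, hcard, hcn, Fintype.card_fin]

end Clusters

end RootPairing.SimpleSystem

theorem lemma2p16 {ι V N : Type*} [Finite ι] [AddCommGroup V] [Module ℝ V]
    [AddCommGroup N] [Module ℝ N] (P : RootPairing ι ℝ V N) [P.IsRootSystem] [P.IsReduced]
    {n : ℕ} (Δ : P.SimpleSystem n)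
    (c w : List (Fin n)) (w₀ : V ≃ₗ[ℝ] V)
    (hc : Δ.IsCoxeterElement (Δ.wordProd c)) (hc' : Δ.IsReducedExpr c (Δ.wordProd c))
    (hw₀ : Δ.IsLongest w₀) (hw : Δ.IsSortingWord c w₀ w) :
    (∀ I : Finset (Fin (c ++ w).length), Δ.IsCluster w₀ (c ++ w) I →
      Δ.RootConfigurationIsBasis (c ++ w) I) ∧
    ∀ (i j : Fin (c ++ w).length) (I I' : Finset (Fin (c ++ w).length))
      (hI : i ∈ I) (hI' : i ∈ I'),
      Δ.IsCluster w₀ (c ++ w) I → Δ.IsCluster w₀ (c ++ w) I' →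
      Δ.compatibilityDegree (c ++ w) I ⟨i, hI⟩ j =
        Δ.compatibilityDegree (c ++ w) I' ⟨i, hI'⟩ j := by
  obtain ⟨hmem, hlen⟩ := Δ.mem_and_length_eq_of_isCoxeterElement hc hc'
  obtain ⟨p, -, hred, -⟩ := hw
  obtain ⟨I₀, hI₀, hbasis⟩ :=
    RootPairing.SimpleSystem.exists_isCluster_isBasis hmem hlen hred
  refine ⟨fun I hI => (hI₀.isBasis_iff_and_rootCoeff_eq hI).1.1 hbasis, ?_⟩
  intro i j I I' hi hi' hI hI'
  rw [RootPairing.SimpleSystem.compatibilityDegree, RootPairing.SimpleSystem.compatibilityDegree,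
    (hI.isBasis_iff_and_rootCoeff_eq hI').2 i hi hi' j]
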